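/- Let $\Gamma$ be a group, $K$ a field, and $v : K^\ast \to \mathbb{Z}$ a discrete (non-archimedean) valuation, normalized so that it is surjective, with $v(0)=\infty$. Let $O_v=\{x\in K : v(x)\geq 0\}$, and let $T_v$ be the Bruhat–Tits tree of $(K,v)$: its vertices are the homothety classes of free $O_v$-submodules of rank $2$ of $K^2$ that span $K^2$, and two vertices are adjacent if and only if there are a basis $(e,f)$ of $K^2$ and an element $t$ with $v(t)=1$ such that they are the classes of $O_v e + O_v f$ and $O_v e + O_v tf$. The group $GL(2,K)$ acts on $T_v$ through its action on column vectors. For an action of $\Gamma$ on a simplicial tree $T$ that fixes a point $\alpha$ of the boundary $\partial T$ (the set of geodesic rays modulo eventual coincidence up to a shift of the parameter), the Busemann cocycle $\omega_\alpha : \Gamma \to \mathbb{Z}$ is the homomorphism $\omega_\alpha(g) = b_r(gx) - b_r(x)$, independent of the vertex $x$, where $r$ is any ray representing $\alpha$ and $b_r(x)=\lim_{t\to\infty}\,(d(x,r(t))-t)$. The action is called parabolic if it fixes a point of $\partial T$, and exceptional if it fixes exactly one point of $\partial T$ and the associated Busemann cocycle is not zero. Let $\chi : \Gamma \to K^\ast$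 be a homomorphism, let $\theta : \Gamma \to K$ be a $1$-cocycle with values in $\chi$, i.e. $\theta(gh)=\theta(g)+\chi(g)\theta(h)$ for all $g,h\in\Gamma$, whose class in $H^1(\Gamma,\chi)$ is not zero (so that $\chi$ is exceptional, i.e. $H^1(\Gamma,\chi)\neq 0$), and let $\rho : \Gamma \to GL(2,K)$ be defined by $$\rho(g)=\begin{pmatrix}\chi(g)&\theta(g)\\0&1\end{pmatrix}.$$ If the homomorphism $v\circ\chi:\Gamma\to\mathbb{Z}$ is not zero, then $T_v$ is a tree and the action of $\Gamma$ on $T_v$ through $\rho$ is exceptional. In particular it is parabolic; it is not loxodromic, in the sense that it leaves no line (bi-infinite geodesic) of $T_v$ invariant. The Busemann cocycle of this action at its fixed point in $\partial T_v$ is $v\circ\chi$. -/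

import Mathlib

universe u

/-! ### Ends of a simplicial tree, Busemann functions, group actions -/

namespace TreeAction

variable {V : Type*} {T : SimpleGraph V}

theorem dist_map_le (e : T ≃g T) (x y : V) :
    T.dist (e x) (e y) ≤ T.dist x y := by
  by_cases h : T.Reachable x y
  · obtain ⟨p, hp⟩ := h.exists_walk_length_eq_dist
    rw [← hp]
    simpa using SimpleGraph.dist_le (p.map e.toHom)
  · have h' : ¬ T.Reachable (e x) (e y) := fun hr => h (by
      simpa using hr.map e.symm.toHom)
    simp [SimpleGraph.dist_eq_zero_of_not_reachable h']

/-- Automorphisms of a graph are isometries. -/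
theorem dist_map (e : T ≃g T) (x y : V) : T.dist (e x) (e y) = T.dist x y := by
  refine le_antisymm (dist_map_le e x y) ?_
  simpa using dist_map_le e.symm (e x) (e y)

/-- A (geodesic) ray of `T`: an isometric map `r : {0, 1, 2, …} → V`. -/
structure Ray (T : SimpleGraph V) where
  toFun : ℕ → V
  isometric : ∀ m n : ℕ, T.dist (toFun m) (toFun (m + n)) = n

instance : CoeFun (Ray T) (fun _ => ℕ → V) := ⟨Ray.toFun⟩

/-- Two rays are asymptotic if they coincide, up to a shift of the parameter, after a
certain time. -/
def Ray.Asymptotic (r s : Ray T) : Prop :=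
  ∃ a b : ℕ, ∀ t : ℕ, r (a + t) = s (b + t)

/-- Asymptoty is an equivalence relation. -/
instance raySetoid (T : SimpleGraph V) : Setoid (Ray T) where
  r := Ray.Asymptotic
  iseqv :=
    { refl := fun _ => ⟨0, 0, fun _ => rfl⟩
      symm := fun ⟨a, b, h⟩ => ⟨b, a, fun t => (h t).symm⟩
      trans := by
        rintro r s q ⟨a, b, h⟩ ⟨c, d, h'⟩
        refine ⟨a + c, d + b, fun t => ?_⟩
        rw [add_assoc, h, add_assoc d, ← h']
        congr 1
        omega }

/-- The boundary `∂T`: the set of ends of `T`, i.e. of asymptoty classes of rays. -/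
def Boundary (T : SimpleGraph V) : Type _ := Quotient (raySetoid T)

/-- The end represented by a ray. -/
def Ray.toEnd (r : Ray T) : Boundary T := Quotient.mk (raySetoid T) r

/-- The image of a ray under an automorphism. -/
def Ray.map (e : T ≃g T) (r : Ray T) : Ray T where
  toFun n := e (r n)
  isometric m n := by rw [dist_map, r.isometric]

/-- The action of an automorphism on the boundary. -/
def Boundary.map (e : T ≃g T) : Boundary T → Boundary T :=
  Quotient.map (Ray.map e) (by
    rintro r s ⟨a, b, h⟩
    exact ⟨a, b, fun t => congrArg e (h t)⟩)

/-- `b` is the Busemann function of the ray `r`: for every vertex `x`, the function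
`t ↦ d(x, r(t)) - t` is eventually constant, equal to `b x`. -/
def IsBusemannFunction (r : Ray T) (b : V → ℤ) : Prop :=
  ∀ x : V, ∀ᶠ t : ℕ in Filter.atTop, (T.dist x (r t) : ℤ) - (t : ℤ) = b x

variable {Γ : Type*} [Group Γ]

/-- The action `ρ` of `Γ` on `T` fixes the point at infinity `α`. -/
def FixesEnd (ρ : Γ →* (T ≃g T)) (α : Boundary T) : Prop :=
  ∀ g : Γ, Boundary.map (ρ g) α = α

/-- The homomorphism `ω : Γ → ℤ` is the Busemann cocycle `ω_α` of the action `ρ` at the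
end `α`: for every ray `r` representing `α`, with Busemann function `b`, the function
`b ∘ g - b` is constant, equal to `ω g`. -/
def IsBusemannCocycle (ρ : Γ →* (T ≃g T)) (α : Boundary T) (ω : Γ →* Multiplicative ℤ) :
    Prop :=
  ∀ r : Ray T, r.toEnd = α →
    ∃ b : V → ℤ, IsBusemannFunction r b ∧
      ∀ (g : Γ) (x : V), b (ρ g x) - b x = Multiplicative.toAdd (ω g)

/-- A parabolic action: it fixes some point at infinity. -/
def IsParabolicAction (ρ : Γ →* (T ≃g T)) : Prop :=
  ∃ α : Boundary T, FixesEnd ρ α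

/-- The action leaves a line invariant: there is a bi-infinite geodesic of `T` which every
element of `Γ` maps onto itself. -/
def PreservesLine (ρ : Γ →* (T ≃g T)) : Prop :=
  ∃ l : ℤ → V, (∀ (m : ℤ) (n : ℕ), T.dist (l m) (l (m + n)) = n) ∧
    ∀ g : Γ, (fun x => ρ g x) '' Set.range l = Set.range l

/-- An exceptional action on a tree: it fixes a unique point at infinity, and the associated
Busemann cocycle is not trivial. -/
structure IsExceptionalAction (ρ : Γ →* (T ≃g T)) : Prop where
  isTree : T.IsTree
  exists_end : ∃ α : Boundary T, FixesEnd ρ α ∧ (∀ β : Boundary T, FixesEnd ρ β → β = α) ∧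
    ∃ ω : Γ →* Multiplicative ℤ, IsBusemannCocycle ρ α ω ∧ ω ≠ 1

end TreeAction

/-! ### The tree of a discretely valued field -/

namespace BruhatTits

open scoped Pointwise

variable {K : Type*} [Field K]

theorem val_unit_ne_top (v : AddValuation K (WithTop ℤ)) (x : Kˣ) : v (x : K) ≠ ⊤ :=
  (AddValuation.ne_top_iff v).2 x.ne_zero

/-- The valuation as a homomorphism `v : Kˣ → ℤ`. -/
def unitVal (v : AddValuation K (WithTop ℤ)) : Kˣ →* Multiplicative ℤ :=
  MonoidHom.mk' (fun x => Multiplicative.ofAdd ((v (x : K)).untop (val_unit_ne_top v x)))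
    (fun x y => by
      rw [← ofAdd_add]
      congr 1
      apply WithTop.coe_injective
      simp [AddValuation.map_mul])

/-- The valuation ring `O_v = {x | v x ≥ 0}`. -/
def valuationRing (v : AddValuation K (WithTop ℤ)) : Subring K where
  carrier := {x | 0 ≤ v x}
  mul_mem' {x y} hx hy := by
    simp only [Set.mem_ofPred_eq, AddValuation.map_mul] at *
    exact add_nonneg hx hy
  one_mem' := by simp
  add_mem' {x y} hx hy := (le_min hx hy).trans (AddValuation.map_add v x y)
  zero_mem' := by simp
  neg_mem' {x} hx := by simpa using hx

/-- An `O_v`-lattice of `K²`: the `O_v`-span of a `K`-basis of `K²`. -/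
structure Lattice (v : AddValuation K (WithTop ℤ)) where
  toSubmodule : Submodule (valuationRing v) (Fin 2 → K)
  exists_basis : ∃ b : Module.Basis (Fin 2) K (Fin 2 → K),
    toSubmodule = Submodule.span (valuationRing v) (Set.range b)

variable {v : AddValuation K (WithTop ℤ)}

theorem Lattice.ext' {L M : Lattice v} (h : L.toSubmodule = M.toSubmodule) : L = M := by
  cases L; cases M; cases h; rfl

/-- The lattice spanned by a basis of `K²`. -/
def Lattice.ofBasis (v : AddValuation K (WithTop ℤ))
    (b : Module.Basis (Fin 2) K (Fin 2 → K)) : Lattice v :=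
  ⟨Submodule.span (valuationRing v) (Set.range b), b, rfl⟩

/-- Two lattices `L`, `M` are homothetic if `M = c L` for some `c ∈ Kˣ`. -/
def Lattice.Homothetic (L M : Lattice v) : Prop :=
  ∃ c : Kˣ, M.toSubmodule = c • L.toSubmodule

instance latticeSetoid (v : AddValuation K (WithTop ℤ)) : Setoid (Lattice v) where
  r := Lattice.Homothetic
  iseqv :=
    { refl := fun _ => ⟨1, (one_smul _ _).symm⟩
      symm := by
        rintro L M ⟨c, h⟩
        exact ⟨c⁻¹, by rw [h, inv_smul_smul]⟩
      trans := by
        rintro L M N ⟨c, h⟩ ⟨d, h'⟩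
        exact ⟨d * c, by rw [h', h, mul_smul]⟩ }

/-- The vertices of `T_v`: homothety classes of lattices. -/
def Vertex (v : AddValuation K (WithTop ℤ)) : Type _ := Quotient (latticeSetoid v)

/-- The homothety class of a lattice. -/
def Lattice.toVertex (L : Lattice v) : Vertex v := Quotient.mk (latticeSetoid v) L

/-- The vertices `x`, `y` are at distance one: there are a basis `(e, f)` of `K²` and a `t`
with `v t = 1` such that `x` is the class of `O_v e + O_v f` and `y` the class of
`O_v e + O_v t f`. -/
def Adjacent (x y : Vertex v) : Prop :=
  ∃ (b : Module.Basis (Fin 2) K (Fin 2 → K)) (t : Kˣ), v (t : K) = 1 ∧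
    x = (Lattice.ofBasis v b).toVertex ∧
    y = (Lattice.ofBasis v (b.unitsSMul ![1, t])).toVertex

/-- An element of `GL(2, K)` as an `O_v`-linear map of `K²` (acting on column vectors). -/
def glMap (v : AddValuation K (WithTop ℤ)) (g : GL (Fin 2) K) :
    (Fin 2 → K) →ₗ[valuationRing v] (Fin 2 → K) :=
  (Matrix.mulVecLin (g : Matrix (Fin 2) (Fin 2) K)).restrictScalars (valuationRing v)

/-- The image of a basis under an element of `GL(2, K)`. -/
noncomputable def glBasis (g : GL (Fin 2) K) (b : Module.Basis (Fin 2) K (Fin 2 → K)) :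
    Module.Basis (Fin 2) K (Fin 2 → K) :=
  b.map (Matrix.GeneralLinearGroup.toLin g).toLinearEquiv

theorem glBasis_apply (g : GL (Fin 2) K) (b : Module.Basis (Fin 2) K (Fin 2 → K)) (i : Fin 2) :
    glBasis g b i = glMap v g (b i) := rfl

theorem map_span_basis (g : GL (Fin 2) K) (b : Module.Basis (Fin 2) K (Fin 2 → K)) :
    (Submodule.span (valuationRing v) (Set.range b)).map (glMap v g) =
      Submodule.span (valuationRing v) (Set.range (glBasis g b)) := by
  rw [Submodule.map_span, ← Set.range_comp]
  rfl

/-- The action of `GL(2, K)` on lattices: `g L = {g x | x ∈ L}`. -/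
def Lattice.glAct (g : GL (Fin 2) K) (L : Lattice v) : Lattice v where
  toSubmodule := L.toSubmodule.map (glMap v g)
  exists_basis := by
    obtain ⟨b, hb⟩ := L.exists_basis
    exact ⟨glBasis g b, by rw [hb, map_span_basis]⟩

theorem Lattice.glAct_ofBasis (g : GL (Fin 2) K) (b : Module.Basis (Fin 2) K (Fin 2 → K)) :
    (Lattice.ofBasis v b).glAct g = Lattice.ofBasis v (glBasis g b) :=
  Lattice.ext' (map_span_basis g b)

theorem Lattice.glAct_one (L : Lattice v) : L.glAct 1 = L := by
  apply Lattice.ext'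
  ext x
  simp [Lattice.glAct, glMap]

theorem Lattice.glAct_mul (g h : GL (Fin 2) K) (L : Lattice v) :
    L.glAct (g * h) = (L.glAct h).glAct g := by
  apply Lattice.ext'
  ext x
  simp [Lattice.glAct, glMap]

/-- The action of `GL(2, K)` on the vertices of `T_v`. -/
def Vertex.glAct (g : GL (Fin 2) K) : Vertex v → Vertex v :=
  Quotient.map (Lattice.glAct g) (by
    rintro L M ⟨c, h⟩
    refine ⟨c, ?_⟩
    ext x
    simp only [Lattice.glAct, h, Submodule.mem_map]
    constructor
    · rintro ⟨_, ⟨y, hy, rfl⟩, rfl⟩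
      exact ⟨glMap v g y, ⟨y, hy, rfl⟩, (Matrix.mulVec_smul _ (c : K) y).symm⟩
    · rintro ⟨_, ⟨y, hy, rfl⟩, rfl⟩
      exact ⟨c • y, ⟨y, hy, rfl⟩, Matrix.mulVec_smul _ (c : K) y⟩)

theorem Vertex.glAct_toVertex (g : GL (Fin 2) K) (L : Lattice v) :
    Vertex.glAct g L.toVertex = (L.glAct g).toVertex := rfl

theorem Vertex.glAct_one (x : Vertex v) : Vertex.glAct 1 x = x := by
  induction x using Quotient.inductionOn with
  | h L => exact congrArg Lattice.toVertex L.glAct_one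

theorem Vertex.glAct_mul (g h : GL (Fin 2) K) (x : Vertex v) :
    Vertex.glAct (g * h) x = Vertex.glAct g (Vertex.glAct h x) := by
  induction x using Quotient.inductionOn with
  | h L => exact congrArg Lattice.toVertex (L.glAct_mul g h)

theorem Adjacent.glAct (g : GL (Fin 2) K) {x y : Vertex v} (h : Adjacent x y) :
    Adjacent (Vertex.glAct g x) (Vertex.glAct g y) := by
  obtain ⟨b, t, ht, rfl, rfl⟩ := h
  refine ⟨glBasis g b, t, ht, ?_, ?_⟩
  · rw [Vertex.glAct_toVertex, Lattice.glAct_ofBasis]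
  · rw [Vertex.glAct_toVertex, Lattice.glAct_ofBasis]
    congr 2
    ext1 i
    rw [glBasis_apply (v := v), Module.Basis.unitsSMul_apply, Module.Basis.unitsSMul_apply,
      glBasis_apply (v := v)]
    exact Matrix.mulVec_smul _ ((![1, t] i : Kˣ) : K) (b i)

theorem Adjacent.symm {x y : Vertex v} (h : Adjacent x y) : Adjacent y x := by
  obtain ⟨b, t, ht, rfl, rfl⟩ := h
  refine ⟨(b.unitsSMul ![1, t]).reindex (Equiv.swap 0 1), t, ht, ?_, ?_⟩
  · congr 1
    apply Lattice.ext'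
    simp only [Lattice.ofBasis, Module.Basis.range_reindex]
  · refine Quotient.sound (s := latticeSetoid v) ⟨t, ?_⟩
    simp only [Lattice.ofBasis]
    refine Eq.trans ?_ (Submodule.map_span _ _).symm
    congr 1
    ext x
    simp only [Set.mem_range, Set.mem_image, Fin.exists_fin_two,
      Module.Basis.unitsSMul_apply, Module.Basis.reindex_apply, Equiv.symm_swap,
      Equiv.swap_apply_left, Equiv.swap_apply_right, Matrix.cons_val_zero, Matrix.cons_val_one,
      one_smul]
    constructor
    · rintro (h | h)
      exacts [⟨b 1, Or.inr rfl, h⟩, ⟨b 0, Or.inl rfl, h⟩]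
    · rintro ⟨y, rfl | rfl, h⟩
      exacts [Or.inr h, Or.inl h]

theorem mem_span_basis_iff (b : Module.Basis (Fin 2) K (Fin 2 → K)) (x : Fin 2 → K) :
    x ∈ Submodule.span (valuationRing v) (Set.range b) ↔ ∀ i, 0 ≤ v (b.repr x i) := by
  constructor
  · intro h i
    induction h using Submodule.span_induction with
    | mem x hx =>
      obtain ⟨j, rfl⟩ := hx
      by_cases hij : j = i <;> simp [hij]
    | zero => simp
    | add x y _ _ hx hy =>
      simpa using (le_min hx hy).trans (AddValuation.map_add v _ _)
    | smul a x _ hx =>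
      have : b.repr (a • x) i = (a : K) * b.repr x i := by
        rw [show a • x = (a : K) • x from rfl]; simp
      rw [this, AddValuation.map_mul]
      exact add_nonneg a.2 hx
  · intro h
    rw [← b.sum_repr x]
    exact Submodule.sum_mem _ fun i _ =>
      Submodule.smul_mem _ (⟨b.repr x i, h i⟩ : valuationRing v)
        (Submodule.subset_span ⟨i, rfl⟩)

theorem not_adjacent_self (x : Vertex v) : ¬ Adjacent x x := by
  rintro ⟨b, t, ht, hx, hy⟩
  obtain ⟨c, hc⟩ := Quotient.exact (s := latticeSetoid v) (hx.symm.trans hy)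
  simp only [Lattice.ofBasis] at hc
  have h1 : b 0 ∈ c • Submodule.span (valuationRing v) (Set.range b) := by
    rw [← hc]
    exact Submodule.subset_span ⟨0, by simp [Module.Basis.unitsSMul_apply]⟩
  have h2 : c • b 1 ∈ Submodule.span (valuationRing v) (Set.range (b.unitsSMul ![1, t])) := by
    rw [hc]
    exact Submodule.smul_mem_pointwise_smul _ _ _ (Submodule.subset_span ⟨1, rfl⟩)
  rw [mem_span_basis_iff] at h2
  obtain ⟨y, hy, hy'⟩ := (Submodule.mem_smul_pointwise_iff_exists _ _ _).1 h1
  have h3 := (mem_span_basis_iff b y).1 hy 0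
  have h4 := h2 1
  have h5 : (c : K) * b.repr y 0 = 1 := by
    have := congrArg (fun z => b.repr z 0) hy'
    simpa [Units.smul_def] using this
  have h6 := congrArg v h5
  rw [AddValuation.map_mul, AddValuation.map_one] at h6
  have h7 : (t : K) * (b.unitsSMul ![1, t]).repr (c • b 1) 1 = c := by
    rw [Module.Basis.repr_unitsSMul]
    simp [Units.smul_def]
  have h8 := congrArg v h7
  rw [AddValuation.map_mul, ht] at h8
  have h9 : (1 : WithTop ℤ) ≤ v (c : K) := by
    rw [← h8]
    exact le_add_of_nonneg_right h4
  have h10 : (1 : WithTop ℤ) ≤ 0 := by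
    rw [← h6]
    exact h9.trans (le_add_of_nonneg_right h3)
  exact absurd h10 (by decide)

/-- The Bruhat–Tits tree `T_v`. -/
def tree (v : AddValuation K (WithTop ℤ)) : SimpleGraph (Vertex v) where
  Adj := Adjacent
  symm := ⟨fun _ _ h => h.symm⟩
  loopless := ⟨not_adjacent_self⟩

/-- The action of `GL(2, K)` on `T_v` by automorphisms. -/
def glAction (v : AddValuation K (WithTop ℤ)) : GL (Fin 2) K →* (tree v ≃g tree v) where
  toFun g :=
    { toFun := Vertex.glAct g
      invFun := Vertex.glAct g⁻¹
      left_inv := fun x => by rw [← Vertex.glAct_mul, inv_mul_cancel, Vertex.glAct_one]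
      right_inv := fun x => by rw [← Vertex.glAct_mul, mul_inv_cancel, Vertex.glAct_one]
      map_rel_iff' := by
        intro x y
        refine ⟨fun h => ?_, fun h => Adjacent.glAct g h⟩
        have := Adjacent.glAct g⁻¹ (show Adjacent (Vertex.glAct g x) (Vertex.glAct g y) from h)
        rwa [← Vertex.glAct_mul, ← Vertex.glAct_mul, inv_mul_cancel, Vertex.glAct_one,
          Vertex.glAct_one] at this }
  map_one' := by
    ext x
    exact Vertex.glAct_one x
  map_mul' g h := by
    ext x
    exact Vertex.glAct_mul g h x

end BruhatTits

/-! ### Characters and affine actions on the line -/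

section Characters

variable {Γ K : Type u} [Group Γ] [Field K]

/-- The `K`-line on which `Γ` acts through the character `χ`. -/
noncomputable abbrev charRep (χ : Γ →* Kˣ) : Rep.{u} K Γ :=
  Rep.of ((Algebra.lmul K K).toMonoidHom.comp ((Units.coeHom K).comp χ))

/-- The affine representation `g ↦ [[χ g, θ g], [0, 1]]` attached to a character `χ` and a
`1`-cocycle `θ` of `Γ` with values in `χ`. -/
def affineRep (χ : Γ →* Kˣ) (θ : groupCohomology.cocycles₁ (charRep χ)) :
    Γ →* GL (Fin 2) K :=
  MonoidHom.mk'
    (fun g => Matrix.GeneralLinearGroup.mkOfDetNeZero !![(χ g : K), θ.1 g; 0, 1]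
      (by simp [Matrix.det_fin_two]))
    (fun g h => by
      have hθ : θ.1 (g * h) = (χ g : K) * θ.1 h + θ.1 g :=
        (groupCohomology.mem_cocycles₁_iff θ.1).1 θ.2 g h
      apply Units.ext
      change !![((χ (g * h) : Kˣ) : K), θ.1 (g * h); 0, 1] =
        !![(χ g : K), θ.1 g; 0, 1] * !![(χ h : K), θ.1 h; 0, 1]
      rw [hθ, Matrix.mul_fin_two]
      simp)

end Characters

/-! ### Graphs with a parent function -/

namespace TreeAction

variable {V : Type*} {T : SimpleGraph V}

/-! Every lattice is homothetic to one spanned by (1, 0) and (s x, s), so the vertices of the tree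
are the balls {y : v (y - x) ≥ -v s} of K, and the edges join a ball to the next larger one. Each
ball has exactly one such parent, and any two balls lie in a common larger one. Hence the graph is a
tree, all rays of growing balls define the same end, and the Busemann function of that end is the
level -v s up to a constant. The matrix of g acts on balls through y ↦ χ g * y + θ g; this commutes
with parents, so the end is fixed, and it shifts levels by v (χ g), which is the Busemann cocycle.

It remains to see that no other end and no line is invariant. A geodesic that once steps to a child
does so ever after. Hence another fixed end, or an invariant line, gives a decreasing sequence of
balls that each g preserves up to a shift; a line that first climbs and then descends is excluded
because its levels are bounded below while some g lowers levels
(`exists_isInvariantDescent_of_preservesLine`). Such balls shrink to a point that is a priori only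
in the completion of K. But some g₀ has v (χ g₀) ≠ 0, so its affine map has a fixed point c in K,
and c turns out to lie in all late balls. Then every g fixes c
(`exists_fixed_of_isInvariantDescent`), and θ is the coboundary of -c, contrary to the hypothesis on
its class. -/

/-- A horofunction on a graph: every vertex `x` has a parent, one level below `x`, all edges
join a vertex to its parent, and any two vertices have a common ancestor. -/
structure Horofunction (T : SimpleGraph V) where
  parent : V → V
  level : V → ℤ
  adj_iff : ∀ x y, T.Adj x y ↔ parent x = y ∨ parent y = x
  level_parent : ∀ x, level (parent x) = level x - 1
  exists_common_ancestor : ∀ x y, ∃ m n : ℕ, parent^[m] x = parent^[n] y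

namespace Horofunction

variable (h : Horofunction T)

theorem adj_parent (x : V) : T.Adj x (h.parent x) := (h.adj_iff _ _).2 (Or.inl rfl)

theorem level_iterate (n : ℕ) (x : V) : h.level (h.parent^[n] x) = h.level x - n := by
  induction n with
  | zero => simp
  | succ n ih =>
    rw [Function.iterate_succ_apply', h.level_parent, ih]
    push_cast
    ring

theorem exists_walk_iterate (n : ℕ) (x : V) :
    ∃ p : T.Walk x (h.parent^[n] x), p.length = n := by
  induction n generalizing x with
  | zero => exact ⟨.nil, rfl⟩
  | succ n ih =>
    obtain ⟨p, hp⟩ := ih (h.parent x)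
    exact ⟨.cons (h.adj_parent x) p, by simp [hp]⟩

/-! ### Tree structure and distances to ancestors. -/

theorem connected (h : Horofunction T) [Nonempty V] : T.Connected := by
  refine ⟨fun x y => ?_⟩
  obtain ⟨m, n, hmn⟩ := h.exists_common_ancestor x y
  obtain ⟨p, -⟩ := h.exists_walk_iterate m x
  obtain ⟨q, -⟩ := h.exists_walk_iterate n y
  exact p.reachable.trans (hmn ▸ q.reachable.symm)

/-- Every edge from x to its parent is a bridge: a walk avoiding it that starts at x never leaves
the descendants of x, and the parent of x is not one of them because its level is too low. -/
theorem isAcyclic (h : Horofunction T) : T.IsAcyclic := by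
  have key : ∀ x, T.IsBridge s(x, h.parent x) := by
    intro x
    rw [SimpleGraph.isBridge_iff]
    rintro ⟨p⟩
    have hstep : ∀ {y z : V} (_ : (T.deleteEdges {s(x, h.parent x)}).Walk y z),
        (∃ n, h.parent^[n] y = x) → ∃ n, h.parent^[n] z = x := by
      intro y z q
      induction q with
      | nil => exact id
      | @cons a b c hab _ ih =>
        rintro ⟨n, hn⟩
        apply ih
        rw [SimpleGraph.deleteEdges_adj] at hab
        rcases (h.adj_iff _ _).1 hab.1 with hp | hp
        · cases n with
          | zero =>
            obtain rfl : a = x := hn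
            subst hp
            simp at hab
          | succ n => exact ⟨n, by rw [← hp, ← Function.iterate_succ_apply, hn]⟩
        · exact ⟨n + 1, by rw [Function.iterate_succ_apply, hp, hn]⟩
    obtain ⟨n, hn⟩ := hstep p ⟨0, rfl⟩
    have := congrArg h.level hn
    rw [h.level_iterate, h.level_parent] at this
    lia
  rw [SimpleGraph.isAcyclic_iff_forall_adj_isBridge]
  intro x y hxy
  rcases (h.adj_iff _ _).1 hxy with rfl | rfl
  · exact key x
  · rw [Sym2.eq_swap]
    exact key y

theorem isTree (h : Horofunction T) [Nonempty V] : T.IsTree := ⟨h.connected, h.isAcyclic⟩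

theorem level_sub_le_length {x y : V} (p : T.Walk x y) : h.level x - h.level y ≤ p.length := by
  induction p with
  | nil => simp
  | @cons a b c hab _ ih =>
    have : h.level a ≤ h.level b + 1 := by
      rcases (h.adj_iff _ _).1 hab with rfl | rfl
      · rw [h.level_parent]; lia
      · rw [h.level_parent]; lia
    rw [SimpleGraph.Walk.length_cons]
    push_cast
    lia

/-- A walk cannot lose more levels than its length, so the path through the ancestors is geodesic.
-/
theorem dist_iterate (n : ℕ) (x : V) : T.dist x (h.parent^[n] x) = n := by
  obtain ⟨p, hp⟩ := h.exists_walk_iterate n x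
  refine le_antisymm ((SimpleGraph.dist_le p).trans_eq hp) ?_
  obtain ⟨q, hq⟩ := p.reachable.exists_walk_length_eq_dist
  have := h.level_sub_le_length q
  rw [h.level_iterate] at this
  lia

/-! ### Ancestor rays, their common end and its Busemann functions. -/

/-- The ray of the ancestors of a vertex. -/
def ray (x : V) : Ray T where
  toFun n := h.parent^[n] x
  isometric m n := by
    rw [add_comm, Function.iterate_add_apply, h.dist_iterate]

theorem ray_apply (x : V) (n : ℕ) : h.ray x n = h.parent^[n] x := rfl

theorem toEnd_ray (x y : V) : (h.ray x).toEnd = (h.ray y).toEnd := by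
  obtain ⟨m, n, hmn⟩ := h.exists_common_ancestor x y
  refine Quotient.sound ⟨m, n, fun t => ?_⟩
  rw [ray_apply, ray_apply, add_comm, Function.iterate_add_apply, hmn,
    ← Function.iterate_add_apply, add_comm]

theorem exists_isBusemannFunction {r : Ray T} {x₀ : V} (hr : r.toEnd = (h.ray x₀).toEnd) :
    ∃ c : ℤ, IsBusemannFunction r (fun x => h.level x + c) := by
  obtain ⟨a, b, hab⟩ : Ray.Asymptotic r (h.ray x₀) := Quotient.exact hr
  -- For large t, r t is the ancestor of x reached after t + (b - a) + (m - n) steps, and m - n is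
  -- the difference of the levels of x and x₀.
  refine ⟨b - a - h.level x₀, fun x => ?_⟩
  obtain ⟨m, n, hmn⟩ := h.exists_common_ancestor x x₀
  filter_upwards [Filter.eventually_ge_atTop (a + n)] with t ht
  obtain ⟨u, rfl⟩ := Nat.exists_eq_add_of_le ht
  have e1 : r (a + n + u) = h.parent^[b + u + m] x := by
    rw [Function.iterate_add_apply, hmn, ← Function.iterate_add_apply, add_assoc, hab, ray_apply,
      add_assoc, add_comm n u]
  have e2 := congrArg h.level hmn
  rw [h.level_iterate, h.level_iterate] at e2
  rw [e1, h.dist_iterate]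
  push_cast
  lia

/-- A vertex has only one parent, so a geodesic that has just descended from x to y cannot climb
again without returning to x. -/
theorem parent_eq_of_dist_eq_two {x y z : V} (hxz : T.dist x z = 2) (hyz : T.dist y z = 1)
    (hy : h.parent y = x) : h.parent z = y := by
  rcases (h.adj_iff _ _).1 (SimpleGraph.dist_eq_one_iff_adj.1 hyz) with hp | hp
  · rw [← hy, hp, SimpleGraph.dist_self] at hxz
    simp at hxz
  · exact hp

theorem ray_ascending_or_descending (r : Ray T) :
    (∀ n, h.parent (r n) = r (n + 1)) ∨ ∃ a, ∀ t, h.parent (r (a + t + 1)) = r (a + t) := by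
  by_cases H : ∃ a, h.parent (r (a + 1)) = r a
  · obtain ⟨a, ha⟩ := H
    refine Or.inr ⟨a, fun t => ?_⟩
    induction t with
    | zero => exact ha
    | succ t ih => exact h.parent_eq_of_dist_eq_two (r.isometric (a + t) 2) (r.isometric (a + t + 1) 1) ih
  · refine Or.inl fun n => ?_
    have hadj := (h.adj_iff _ _).1 (SimpleGraph.dist_eq_one_iff_adj.1 (r.isometric n 1))
    exact hadj.resolve_right fun hn => H ⟨n, hn⟩

theorem toEnd_of_ascending {r : Ray T} (hr : ∀ n, h.parent (r n) = r (n + 1)) (x : V) :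
    r.toEnd = (h.ray x).toEnd := by
  rw [h.toEnd_ray x (r 0)]
  refine Quotient.sound ⟨0, 0, fun t => ?_⟩
  rw [ray_apply, zero_add]
  induction t with
  | zero => rfl
  | succ t ih => rw [Function.iterate_succ_apply', ← ih, hr]

/-! ### Group actions: fixed ends and invariant lines. -/

variable {Γ : Type*} [Group Γ]

/-- A descending sequence of vertices, each the parent of the next one, which every element
of the group preserves up to a shift. -/
def IsInvariantDescent (ρ : Γ →* (T ≃g T)) (s : ℕ → V) : Prop :=
  (∀ n, h.parent (s (n + 1)) = s n) ∧ ∀ g, ∃ a b, ∀ t, ρ g (s (a + t)) = s (b + t)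

variable {ρ : Γ →* (T ≃g T)} {ω : Γ →* Multiplicative ℤ}

theorem fixesEnd_ray (hρ : ∀ g x, h.parent (ρ g x) = ρ g (h.parent x)) (x : V) :
    FixesEnd ρ (h.ray x).toEnd := by
  intro g
  -- The base point becomes `ρ g x` on both sides and is then moved back to x on the left only; the
  -- two rays now agree term by term.
  rw [h.toEnd_ray x (ρ g x)]
  refine (congrArg (Boundary.map (ρ g)) (h.toEnd_ray (ρ g x) x)).trans ?_
  refine Quotient.sound ⟨0, 0, fun t => ?_⟩
  change ρ g (h.parent^[0 + t] x) = h.parent^[0 + t] (ρ g x)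
  generalize 0 + t = n
  induction n with
  | zero => rfl
  | succ n ih => rw [Function.iterate_succ_apply', Function.iterate_succ_apply', ← ih, hρ]

theorem isBusemannCocycle_ray
    (hω : ∀ g x, h.level (ρ g x) = h.level x + Multiplicative.toAdd (ω g)) (x : V) :
    IsBusemannCocycle ρ (h.ray x).toEnd ω := by
  intro r hr
  obtain ⟨c, hc⟩ := h.exists_isBusemannFunction hr
  exact ⟨_, hc, fun g y => by rw [hω]; ring⟩

theorem eq_or_exists_isInvariantDescent {β : Boundary T} (hβ : FixesEnd ρ β) (x : V) :
    β = (h.ray x).toEnd ∨ ∃ s, h.IsInvariantDescent ρ s := by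
  induction β using Quotient.inductionOn with
  | h r =>
    rcases h.ray_ascending_or_descending r with hr | ⟨c, hc⟩
    · exact Or.inl (h.toEnd_of_ascending hr x)
    · refine Or.inr ⟨fun n => r (c + n), hc, fun g => ?_⟩
      obtain ⟨a, b, hab⟩ : Ray.Asymptotic (Ray.map (ρ g) r) r := Quotient.exact (hβ g)
      refine ⟨a, b, fun t => ?_⟩
      have := hab (c + t)
      rw [add_left_comm, add_left_comm b] at this
      exact this

theorem isInvariantDescent_of_line
    (hω : ∀ g x, h.level (ρ g x) = h.level x + Multiplicative.toAdd (ω g))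
    {l : ℤ → V} (hl : ∀ k, h.parent (l (k + 1)) = l k)
    (hinv : ∀ g k, ρ g (l k) ∈ Set.range l) : h.IsInvariantDescent ρ (fun n => l n) := by
  have hlev : ∀ k, h.level (l k) = h.level (l 0) + k := by
    have hs : ∀ k, h.level (l (k + 1)) = h.level (l k) + 1 := fun k => by
      rw [← hl k, h.level_parent]; ring
    intro k
    induction k with
    | zero => simp
    | succ k ih => rw [hs, ih]; ring
    | pred k ih =>
      have := hs (-k - 1)
      rw [sub_add_cancel] at this
      lia
  refine ⟨fun n => by exact_mod_cast hl n, fun g => ?_⟩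
  set w := Multiplicative.toAdd (ω g) with hw
  -- The level determines a point of l, so g translates l by the amount by which it shifts levels.
  have hg : ∀ k, ρ g (l k) = l (k + w) := by
    intro k
    obtain ⟨j, hj⟩ := hinv g k
    have := congrArg h.level hj
    rw [hω, hlev, hlev k, ← hw] at this
    rw [← hj]
    congr 1
    lia
  -- Any two indices differing by w would do; starting at |w| keeps both natural.
  refine ⟨w.natAbs, (w.natAbs + w).toNat, fun t => ?_⟩
  rw [hg]
  congr 1
  lia

theorem exists_isInvariantDescent_of_preservesLine
    (hω : ∀ g x, h.level (ρ g x) = h.level x + Multiplicative.toAdd (ω g)) (hne : ω ≠ 1)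
    (hl : PreservesLine ρ) : ∃ s, h.IsInvariantDescent ρ s := by
  obtain ⟨l, hiso, hinv⟩ := hl
  have hinv' : ∀ g k, ρ g (l k) ∈ Set.range l := fun g k => by
    rw [← hinv g]
    exact ⟨l k, ⟨k, rfl⟩, rfl⟩
  have hup : ∀ k, h.parent (l (k + 1)) ≠ l k → h.parent (l k) = l (k + 1) := fun k hk =>
    ((h.adj_iff _ _).1 (SimpleGraph.dist_eq_one_iff_adj.1 (hiso k 1))).resolve_right hk
  have hdown : ∀ k, h.parent (l (k + 1)) = l k → h.parent (l (k + 1 + 1)) = l (k + 1) :=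
    fun k hk => h.parent_eq_of_dist_eq_two (by have := hiso k 2; rwa [Nat.cast_two, ← one_add_one_eq_two,
      ← add_assoc] at this) (hiso (k + 1) 1) hk
  by_cases hD : ∃ j, h.parent (l (j + 1)) = l j
  · obtain ⟨j, hj⟩ := hD
    by_cases hU : ∃ i, h.parent (l (i + 1)) ≠ l i
    · exfalso
      obtain ⟨i, hi⟩ := hU
      have hmono : ∀ k, h.parent (l (k + 1)) = l k → ∀ m, k ≤ m →
          h.parent (l (m + 1)) = l m := fun k hk m hm =>
        Int.leInduction (motive := fun m _ => h.parent (l (m + 1)) = l m) hk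
          (fun n _ hn => hdown n hn) m hm
      -- The line climbs up to `l k` and descends afterwards, so the level is minimal on it at k.
      obtain ⟨k, hk, hleast⟩ := Int.exists_least_of_bdd
        (P := fun k => h.parent (l (k + 1)) = l k)
        ⟨i, fun m hm => by
          by_contra hlt
          exact hi (hmono m hm i (by lia))⟩ ⟨j, hj⟩
      have hge : ∀ m, k ≤ m → h.level (l k) ≤ h.level (l m) := fun m hm => by
        refine Int.leInduction (motive := fun m _ => h.level (l k) ≤ h.level (l m)) le_rfl
          (fun n hn ih => ?_) m hm
        have := congrArg h.level (hmono k hk n hn)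
        rw [h.level_parent] at this
        lia
      have hle : ∀ m, m ≤ k → h.level (l k) ≤ h.level (l m) := fun m hm => by
        refine Int.leInductionDown (motive := fun m _ => h.level (l k) ≤ h.level (l m)) le_rfl
          (fun n hn ih => ?_) m hm
        have hn' := hup (n - 1) fun hc => by
          have := hleast _ hc
          lia
        have := congrArg h.level hn'
        rw [h.level_parent, sub_add_cancel] at this
        lia
      -- A nonzero homomorphism to ℤ takes a negative value, at g or at its inverse; such a g would
      -- push `l k` below the minimal level.
      obtain ⟨g, hg⟩ : ∃ g, Multiplicative.toAdd (ω g) < 0 := by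
        by_contra! hpos
        refine hne (MonoidHom.ext fun g => ?_)
        have h1 := hpos g
        have h2 := hpos g⁻¹
        rw [map_inv, toAdd_inv] at h2
        exact Multiplicative.toAdd.injective (by rw [MonoidHom.one_apply, toAdd_one]; lia)
      obtain ⟨m, hm⟩ := hinv' g k
      have := hω g (l k)
      rw [← hm] at this
      rcases le_total k m with hkm | hkm
      · have := hge m hkm
        lia
      · have := hle m hkm
        lia
    · push Not at hU
      exact ⟨_, h.isInvariantDescent_of_line hω hU hinv'⟩
  · push Not at hD
    refine ⟨_, h.isInvariantDescent_of_line (l := fun k => l (-k)) hω (fun k => ?_) ?_⟩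
    · have := hup (-(k + 1)) (hD _)
      rw [this]
      congr 1
      ring
    · intro g k
      obtain ⟨j, hj⟩ := hinv' g (-k)
      exact ⟨-j, by simpa using hj⟩

end Horofunction

end TreeAction

/-! ### The vertices of the Bruhat–Tits tree as balls -/

namespace BruhatTits

open scoped Pointwise

variable {K : Type*} [Field K] {v : AddValuation K (WithTop ℤ)}

theorem coe_unitVal (v : AddValuation K (WithTop ℤ)) (s : Kˣ) :
    ((Multiplicative.toAdd (unitVal v s) : ℤ) : WithTop ℤ) = v (s : K) :=
  WithTop.coe_untop _ _

theorem le_val_inv_mul_iff (s : Kˣ) (y : K) : 0 ≤ v ((s : K)⁻¹ * y) ↔ v (s : K) ≤ v y := by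
  conv_rhs => rw [← mul_inv_cancel_left₀ s.ne_zero y, AddValuation.map_mul,
    ← add_zero (v (s : K)), add_assoc, zero_add]
  exact (WithTop.add_le_add_iff_left (val_unit_ne_top v s)).symm

theorem mem_units_smul_iff (c : Kˣ) (M : Submodule (valuationRing v) (Fin 2 → K))
    (z : Fin 2 → K) : z ∈ c • M ↔ c⁻¹ • z ∈ M := by
  refine Iff.trans (Submodule.mem_smul_pointwise_iff_exists _ _ _) ?_
  constructor
  · rintro ⟨y, hy, rfl⟩
    rwa [inv_smul_smul]
  · exact fun h => ⟨_, h, smul_inv_smul _ _⟩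

/-- The basis `(1, 0)`, `(s x, s)` of `K²`. -/
noncomputable def ballBasis (x : K) (s : Kˣ) : Module.Basis (Fin 2) K (Fin 2 → K) :=
  Module.Basis.ofEquivFun
    { toFun := fun z => ![z 0 - x * z 1, (s : K)⁻¹ * z 1]
      invFun := fun z => ![z 0 + x * s * z 1, s * z 1]
      map_add' := fun y z => by
        ext i; fin_cases i <;> simp <;> ring
      map_smul' := fun a z => by
        ext i; fin_cases i <;> simp <;> ring
      left_inv := fun z => by
        ext i; fin_cases i <;> simp [mul_assoc]
      right_inv := fun z => by
        ext i; fin_cases i <;> simp [mul_assoc] }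

theorem ballBasis_repr (x : K) (s : Kˣ) (z : Fin 2 → K) :
    ⇑((ballBasis x s).repr z) = ![z 0 - x * z 1, (s : K)⁻¹ * z 1] := rfl

theorem ballBasis_zero (x : K) (s : Kˣ) : ballBasis x s 0 = ![1, 0] := by
  rw [Module.Basis.apply_eq_iff]
  ext i
  rw [ballBasis_repr]
  fin_cases i <;> simp

theorem ballBasis_one (x : K) (s : Kˣ) : ballBasis x s 1 = ![s * x, s] := by
  rw [Module.Basis.apply_eq_iff]
  ext i
  rw [ballBasis_repr]
  fin_cases i <;> simp [mul_comm]

/-- The vertex attached to the closed ball of centre `x` and radius `-v s`: the class of the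
lattice spanned by `(1, 0)` and `(s x, s)`. -/
noncomputable def ballVertex (v : AddValuation K (WithTop ℤ)) (x : K) (s : Kˣ) : Vertex v :=
  (Lattice.ofBasis v (ballBasis x s)).toVertex

theorem mem_ball_lattice (x : K) (s : Kˣ) (z : Fin 2 → K) :
    z ∈ (Lattice.ofBasis v (ballBasis x s)).toSubmodule ↔
      0 ≤ v (z 0 - x * z 1) ∧ v (s : K) ≤ v (z 1) := by
  rw [Lattice.ofBasis, mem_span_basis_iff, Fin.forall_fin_two, ballBasis_repr,
    ← le_val_inv_mul_iff s]
  rfl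

/-- Two of these lattices are homothetic only if they are equal, since both meet the line K (1, 0)
in the multiples of (1, 0) by O_v. The criterion is then equality of two balls: same radius, and
centres no further apart than it. -/
theorem ballVertex_eq_iff (x y : K) (s t : Kˣ) :
    ballVertex v x s = ballVertex v y t ↔
      unitVal v s = unitVal v t ∧
        ((-Multiplicative.toAdd (unitVal v s) : ℤ) : WithTop ℤ) ≤ v (x - y) := by
  have hval : unitVal v s = unitVal v t ↔ v (s : K) = v (t : K) := by
    rw [← coe_unitVal, ← coe_unitVal, WithTop.coe_inj, Multiplicative.toAdd.apply_eq_iff_eq]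
  have hdist : ((-Multiplicative.toAdd (unitVal v s) : ℤ) : WithTop ℤ) ≤ v (x - y) ↔
      0 ≤ v (s * (x - y)) := by
    have := le_val_inv_mul_iff (v := v) s⁻¹ (x - y)
    rw [← coe_unitVal, map_inv, toAdd_inv, Units.val_inv_eq_inv_val, inv_inv] at this
    exact this.symm
  rw [hval, hdist]
  constructor
  · intro h
    obtain ⟨c, hc⟩ : Lattice.Homothetic _ _ := Quotient.exact (s := latticeSetoid v) h
    have key : ∀ z : Fin 2 → K, (0 ≤ v (z 0 - y * z 1) ∧ v (t : K) ≤ v (z 1)) ↔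
        (0 ≤ v ((c : K)⁻¹ * (z 0 - x * z 1)) ∧ v (s : K) ≤ v ((c : K)⁻¹ * z 1)) := by
      intro z
      rw [← mem_ball_lattice, hc, mem_units_smul_iff, mem_ball_lattice]
      simp [Units.smul_def, mul_sub, mul_left_comm]
    have h0 : v (c : K) = 0 := by
      have h1 := ((key ![1, 0]).1 (by simp)).1
      have h2 := ((key ![(c : K), 0]).2 (by simp)).1
      rw [le_val_inv_mul_iff] at h1
      exact le_antisymm (by simpa using h1) (by simpa using h2)
    have hc' : ∀ z, v ((c : K)⁻¹ * z) = v z := fun z => by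
      rw [AddValuation.map_mul, AddValuation.map_inv, h0]
      simp
    simp only [hc'] at key
    have h1 := (key ![s * x, s]).2 (by simp [mul_comm])
    have h2 := (key ![t * y, t]).1 (by simp [mul_comm])
    refine ⟨le_antisymm (by simpa using h2.2) (by simpa using h1.2), ?_⟩
    simpa [mul_sub, mul_comm] using h1.1
  · rintro ⟨hst, hxy⟩
    refine congrArg Lattice.toVertex (Lattice.ext' (Submodule.ext fun z => ?_))
    rw [mem_ball_lattice, mem_ball_lattice, hst]
    refine and_congr_left fun hz => ?_
    have hxyz : 0 ≤ v ((x - y) * z 1) := by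
      have : (x - y) * z 1 = (s * (x - y)) * ((s : K)⁻¹ * z 1) := by
        field_simp
      rw [this, AddValuation.map_mul]
      exact add_nonneg hxy ((le_val_inv_mul_iff s _).2 (hst ▸ hz))
    have e1 : z 0 - y * z 1 = (z 0 - x * z 1) + (x - y) * z 1 := by ring
    have e2 : z 0 - x * z 1 = (z 0 - y * z 1) - (x - y) * z 1 := by ring
    exact ⟨fun h => e1 ▸ AddValuation.map_le_add v h hxyz,
      fun h => e2 ▸ AddValuation.map_le_sub v h hxyz⟩

/-! ### Reduction of arbitrary bases and edges to balls. -/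

theorem ofBasis_reindex_swap (b : Module.Basis (Fin 2) K (Fin 2 → K)) :
    Lattice.ofBasis v (b.reindex (Equiv.swap 0 1)) = Lattice.ofBasis v b := by
  apply Lattice.ext'
  simp only [Lattice.ofBasis, Module.Basis.range_reindex]

theorem exists_units_of_basis (b : Module.Basis (Fin 2) K (Fin 2 → K))
    (hle : v (b 1 1) ≤ v (b 0 1)) :
    ∃ e d : Kˣ, b 1 1 = e ∧ (d : K) = b 0 0 - b 0 1 / b 1 1 * b 1 0 := by
  have he : b 1 1 ≠ 0 := by
    intro h1
    have h0 : b 0 1 = 0 := by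
      rw [h1, AddValuation.map_zero, top_le_iff] at hle
      exact (AddValuation.top_iff v).1 hle
    have := congrFun (b.sum_repr ![0, 1]) 1
    simp [h0, h1] at this
  refine ⟨Units.mk0 _ he, Units.mk0 _ fun hd => ?_, rfl, rfl⟩
  have hz : b 0 - (b 0 1 / b 1 1) • b 1 = 0 := by
    ext i
    fin_cases i
    · simpa using hd
    · simp [he]
  have := congrArg (fun z => b.repr z 0) hz
  simp at this

/-- One elimination step over O_v: subtracting the integral multiple b 0 1 / b 1 1 of `b 1` from `b
0` leaves (d, 0), and dividing the lattice by d gives the normal form. -/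
theorem toVertex_ofBasis (b : Module.Basis (Fin 2) K (Fin 2 → K))
    (hle : v (b 1 1) ≤ v (b 0 1)) {e d : Kˣ} (he : b 1 1 = e)
    (hd : (d : K) = b 0 0 - b 0 1 / b 1 1 * b 1 0) :
    (Lattice.ofBasis v b).toVertex = ballVertex v (b 1 0 / b 1 1) (e / d) := by
  symm
  refine Quotient.sound (s := latticeSetoid v) ⟨d, Submodule.ext fun z => ?_⟩
  rw [mem_units_smul_iff, mem_ball_lattice, Lattice.ofBasis, mem_span_basis_iff,
    Fin.forall_fin_two]
  set α := b.repr z 0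
  set β := b.repr z 1
  have hz : ∀ i, z i = α * b 0 i + β * b 1 i := fun i => by
    conv_lhs => rw [← b.sum_repr z]
    simp [α, β]
  have e1 : (d⁻¹ • z) 0 - b 1 0 / b 1 1 * (d⁻¹ • z) 1 = α := by
    have hdz : ∀ i, (d⁻¹ • z) i = (d : K)⁻¹ * z i := fun i => by simp [Units.smul_def]
    rw [hdz, hdz, hz, hz, inv_mul_eq_div, inv_mul_eq_div]
    have hd0 : (d : K) ≠ 0 := d.ne_zero
    have he0 : b 1 1 ≠ 0 := he ▸ e.ne_zero
    rw [mul_div_assoc', ← sub_div, div_eq_iff hd0, hd]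
    field_simp
    ring
  have e2 : v ((e / d : Kˣ) : K) ≤ v ((d⁻¹ • z) 1) ↔ 0 ≤ v (α * (b 0 1 / b 1 1) + β) := by
    rw [← le_val_inv_mul_iff]
    have : (((e / d : Kˣ) : K))⁻¹ * (d⁻¹ • z) 1 = α * (b 0 1 / b 1 1) + β := by
      have hd0 : (d : K) ≠ 0 := d.ne_zero
      have he0 : (e : K) ≠ 0 := e.ne_zero
      simp only [Units.smul_def, Pi.smul_apply, hz, he, smul_eq_mul, Units.val_div_eq_div_val,
        Units.val_inv_eq_inv_val]
      field_simp
    rw [this]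
  rw [e1, e2]
  refine and_congr_right fun hα => ?_
  have hq : 0 ≤ v (α * (b 0 1 / b 1 1)) := by
    rw [AddValuation.map_mul, he, div_eq_inv_mul]
    exact add_nonneg hα ((le_val_inv_mul_iff _ _).2 (he ▸ hle))
  exact ⟨fun h => AddValuation.map_le_add v hq h,
    fun h => by simpa using AddValuation.map_le_sub v h hq⟩

theorem exists_eq_ballVertex (X : Vertex v) : ∃ x s, X = ballVertex v x s := by
  induction X using Quotient.inductionOn with
  | h L =>
    obtain ⟨b, hb⟩ := L.exists_basis
    obtain rfl : L = Lattice.ofBasis v b := Lattice.ext' hb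
    have key : ∀ b : Module.Basis (Fin 2) K (Fin 2 → K), v (b 1 1) ≤ v (b 0 1) →
        ∃ x s, (Lattice.ofBasis v b).toVertex = ballVertex v x s := fun b hle => by
      obtain ⟨e, d, he, hd⟩ := exists_units_of_basis b hle
      exact ⟨_, _, toVertex_ofBasis b hle he hd⟩
    rcases le_total (v (b 1 1)) (v (b 0 1)) with h | h
    · exact key b h
    · have := key (b.reindex (Equiv.swap 0 1)) (by simpa using h)
      rwa [ofBasis_reindex_swap] at this

theorem adjacent_ballVertex {t : Kˣ} (ht : v (t : K) = 1) (x : K) (s : Kˣ) :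
    Adjacent (ballVertex v x s) (ballVertex v x (t * s)) := by
  refine ⟨ballBasis x s, t, ht, rfl, ?_⟩
  rw [ballVertex]
  congr 2
  ext1 i
  rw [Module.Basis.unitsSMul_apply]
  fin_cases i
  · simp [ballBasis_zero]
  · simp [ballBasis_one, Units.smul_def, mul_assoc]

/-- Which end of the edge is the larger ball depends on the pivot. If `b 1` is the only possible
pivot, it remains one after scaling by t, and e is multiplied by t, so Y is the larger ball.
Otherwise `b 0` serves as pivot for both bases, d is multiplied by t, and X is the larger one. -/
theorem Adjacent.exists_ballVertex {X Y : Vertex v} (h : Adjacent X Y) :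
    ∃ (x : K) (s t : Kˣ), v (t : K) = 1 ∧
      ((X = ballVertex v x s ∧ Y = ballVertex v x (t * s)) ∨
        (Y = ballVertex v x s ∧ X = ballVertex v x (t * s))) := by
  obtain ⟨b, t, ht, rfl, rfl⟩ := h
  rcases lt_or_ge (v (b 1 1)) (v (b 0 1)) with hlt | hge
  · obtain ⟨e, d, he, hd⟩ := exists_units_of_basis b hlt.le
    have hb0 : b.unitsSMul ![1, t] 0 = b 0 := by simp [Module.Basis.unitsSMul_apply]
    have hb1 : b.unitsSMul ![1, t] 1 = t • b 1 := by simp [Module.Basis.unitsSMul_apply]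
    have hq : ∀ a : K, a / (t * e) * t = a / e := fun a => by
      have := t.ne_zero
      have := e.ne_zero
      field_simp
    refine ⟨_, _, t, ht, Or.inl ⟨toVertex_ofBasis b hlt.le he hd, ?_⟩⟩
    rw [toVertex_ofBasis (b.unitsSMul ![1, t]) (e := t * e) (d := d), ← mul_div_assoc]
    · congr 1
      rw [hb1]
      simp [Units.smul_def, mul_div_mul_left]
    · rw [hb0, hb1, Pi.smul_apply, Units.smul_def, smul_eq_mul, AddValuation.map_mul, ht]
      -- The strict inequality leaves room for the extra 1, valuations being integers or ∞.
      rw [he, ← coe_unitVal] at hlt ⊢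
      generalize v (b 0 1) = w at hlt ⊢
      induction w with
      | top => exact le_top
      | coe w =>
        rw [WithTop.coe_lt_coe] at hlt
        rw [← WithTop.coe_one, ← WithTop.coe_add, WithTop.coe_le_coe]
        lia
    · simp [hb1, he, Units.smul_def]
    · simp [hb0, hb1, hd, he, Units.smul_def, ← mul_assoc, hq]
  · have hsw : v ((b.reindex (Equiv.swap 0 1)) 1 1) ≤ v ((b.reindex (Equiv.swap 0 1)) 0 1) := by
      simpa using hge
    obtain ⟨e, d, he, hd⟩ := exists_units_of_basis _ hsw
    set b' := (b.unitsSMul ![1, t]).reindex (Equiv.swap 0 1)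
    have hb0 : b' 0 = t • b.reindex (Equiv.swap 0 1) 0 := by
      simp [b', Module.Basis.unitsSMul_apply]
    have hb1 : b' 1 = b.reindex (Equiv.swap 0 1) 1 := by
      simp [b', Module.Basis.unitsSMul_apply]
    have hY : (Lattice.ofBasis v (b.unitsSMul ![1, t])).toVertex =
        ballVertex v (b' 1 0 / b' 1 1) (e / (t * d)) := by
      rw [← ofBasis_reindex_swap]
      refine toVertex_ofBasis b' ?_ (by rw [hb1, he]) ?_
      · rw [hb1, hb0, Pi.smul_apply, Units.smul_def, smul_eq_mul, AddValuation.map_mul, ht]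
        exact hsw.trans (le_add_of_nonneg_left zero_le_one)
      · rw [hb0, hb1, Units.val_mul, hd]
        simp only [Units.smul_def, Pi.smul_apply, smul_eq_mul]
        ring
    refine ⟨_, _, t, ht, Or.inr ⟨hY, ?_⟩⟩
    rw [← ofBasis_reindex_swap, toVertex_ofBasis _ hsw he hd, hb1]
    congr 1
    rw [mul_div_assoc', mul_div_mul_left_eq_div]

end BruhatTits

/-! ### The horofunction of the Bruhat–Tits tree at the end of the line `K (1, 0)` -/

namespace BruhatTits

section Horofunction

variable {K : Type*} [Field K] {v : AddValuation K (WithTop ℤ)}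

theorem toAdd_unitVal_of_val_eq_one {t : Kˣ} (ht : v (t : K) = 1) :
    Multiplicative.toAdd (unitVal v t) = 1 := by
  rw [← coe_unitVal] at ht
  exact_mod_cast ht

theorem ballVertex_congr (x : K) {s t : Kˣ} (h : unitVal v s = unitVal v t) :
    ballVertex v x s = ballVertex v x t :=
  (ballVertex_eq_iff x x s t).2 ⟨h, by simp⟩

/-- A centre of the ball attached to a vertex. -/
noncomputable def center (X : Vertex v) : K := (exists_eq_ballVertex X).choose

/-- A scalar whose valuation is the opposite of the radius of the ball attached to a vertex. -/
noncomputable def scale (X : Vertex v) : Kˣ := (exists_eq_ballVertex X).choose_spec.choose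

theorem ballVertex_center_scale (X : Vertex v) : ballVertex v (center X) (scale X) = X :=
  (exists_eq_ballVertex X).choose_spec.choose_spec.symm

/-- The radius of the ball attached to a vertex. -/
noncomputable def level (X : Vertex v) : ℤ := -Multiplicative.toAdd (unitVal v (scale X))

theorem level_ballVertex (x : K) (s : Kˣ) :
    level (ballVertex v x s) = -Multiplicative.toAdd (unitVal v s) := by
  rw [level, ((ballVertex_eq_iff _ _ _ _).1 (ballVertex_center_scale (ballVertex v x s))).1]

/-- The parent of the vertex attached to a ball: the next larger ball with the same centre. -/
noncomputable def parent (t : Kˣ) (X : Vertex v) : Vertex v :=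
  ballVertex v (center X) (t * scale X)

theorem parent_ballVertex {t : Kˣ} (ht : v (t : K) = 1) (x : K) (s : Kˣ) :
    parent t (ballVertex v x s) = ballVertex v x (t * s) := by
  obtain ⟨h1, h2⟩ :=
    (ballVertex_eq_iff _ _ _ _).1 (ballVertex_center_scale (ballVertex v x s))
  refine (ballVertex_eq_iff _ _ _ _).2 ⟨by rw [map_mul, map_mul, h1], le_trans ?_ h2⟩
  rw [WithTop.coe_le_coe, map_mul, toAdd_mul, toAdd_unitVal_of_val_eq_one ht]
  lia

theorem level_parent {t : Kˣ} (ht : v (t : K) = 1) (X : Vertex v) :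
    level (parent t X) = level X - 1 := by
  rw [parent, level_ballVertex, level, map_mul, toAdd_mul, toAdd_unitVal_of_val_eq_one ht]
  ring

theorem iterate_parent_ballVertex {t : Kˣ} (ht : v (t : K) = 1) (x : K) (s : Kˣ) (n : ℕ) :
    (parent t)^[n] (ballVertex v x s) = ballVertex v x (t ^ n * s) := by
  induction n with
  | zero => simp
  | succ n ih => rw [Function.iterate_succ_apply', ih, parent_ballVertex ht, pow_succ', mul_assoc]

theorem adj_tree_iff {t : Kˣ} (ht : v (t : K) = 1) (X Y : Vertex v) :
    (tree v).Adj X Y ↔ parent t X = Y ∨ parent t Y = X := by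
  have hadj : ∀ X : Vertex v, Adjacent X (parent t X) := fun X => by
    conv_lhs => rw [← ballVertex_center_scale X]
    exact adjacent_ballVertex ht _ _
  have hpar : ∀ (x : K) (s u : Kˣ), v (u : K) = 1 →
      parent t (ballVertex v x s) = ballVertex v x (u * s) := fun x s u hu => by
    rw [parent_ballVertex ht]
    apply ballVertex_congr
    rw [map_mul, map_mul]
    congr 1
    exact Multiplicative.toAdd.injective
      ((toAdd_unitVal_of_val_eq_one ht).trans (toAdd_unitVal_of_val_eq_one hu).symm)
  constructor
  · intro h
    obtain ⟨x, s, u, hu, ⟨rfl, rfl⟩ | ⟨rfl, rfl⟩⟩ := Adjacent.exists_ballVertex h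
    · exact Or.inl (hpar x s u hu)
    · exact Or.inr (hpar x s u hu)
  · rintro (rfl | rfl)
    · exact hadj X
    · exact (hadj Y).symm

theorem exists_iterate_parent_eq {t : Kˣ} (ht : v (t : K) = 1) (X Y : Vertex v) :
    ∃ m n : ℕ, (parent t)^[m] X = (parent t)^[n] Y := by
  obtain ⟨x, r, rfl⟩ := exists_eq_ballVertex X
  obtain ⟨y, s, rfl⟩ := exists_eq_ballVertex Y
  obtain ⟨M, hM⟩ : ∃ M : ℤ, (M : WithTop ℤ) ≤ v (x - y) := by
    generalize v (x - y) = w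
    induction w with
    | top => exact ⟨0, le_top⟩
    | coe w => exact ⟨w, le_rfl⟩
  set a := Multiplicative.toAdd (unitVal v r) with ha
  set b := Multiplicative.toAdd (unitVal v s) with hb
  -- The ball of level -N about either centre contains both given balls.
  set N := max (-M) (max a b)
  have h1 : -M ≤ N := le_max_left _ _
  have h2 : a ≤ N := (le_max_left _ _).trans (le_max_right _ _)
  have h3 : b ≤ N := (le_max_right _ _).trans (le_max_right _ _)
  refine ⟨(N - a).toNat, (N - b).toNat, ?_⟩
  have hval : ∀ (u : Kˣ), Multiplicative.toAdd (unitVal v u) ≤ N →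
      Multiplicative.toAdd (unitVal v
        (t ^ (N - Multiplicative.toAdd (unitVal v u)).toNat * u)) = N := fun u hu => by
    rw [map_mul, map_pow, toAdd_mul, toAdd_pow, toAdd_unitVal_of_val_eq_one ht, nsmul_one]
    lia
  rw [iterate_parent_ballVertex ht, iterate_parent_ballVertex ht, ballVertex_eq_iff]
  refine ⟨Multiplicative.toAdd.injective ((hval r h2).trans (hval s h3).symm), le_trans ?_ hM⟩
  rw [hval r h2, WithTop.coe_le_coe]
  lia

/-- The horofunction of the Bruhat–Tits tree at the end of the line `K (1, 0)`. -/
noncomputable def horofunction {t : Kˣ} (ht : v (t : K) = 1) :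
    TreeAction.Horofunction (tree v) where
  parent := parent t
  level := level
  adj_iff := adj_tree_iff ht
  level_parent := level_parent ht
  exists_common_ancestor := exists_iterate_parent_eq ht

end Horofunction

/-! ### The affine action on balls and its fixed points. -/

section AffineAction

variable {Γ K : Type u} [Group Γ] [Field K] {v : AddValuation K (WithTop ℤ)}
  {χ : Γ →* Kˣ} {θ : groupCohomology.cocycles₁ (charRep χ)}

/-- The affine transformation `x ↦ χ g * x + θ g` of the line `K`. -/
def affineMap (χ : Γ →* Kˣ) (θ : groupCohomology.cocycles₁ (charRep χ)) (g : Γ) (x : K) : K :=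
  (χ g : K) * x + (show K from θ.1 g)

theorem affineMap_sub (g : Γ) (x y : K) :
    affineMap χ θ g x - affineMap χ θ g y = χ g * (x - y) := by
  simp only [affineMap]
  ring

theorem affine_smul_ballVertex (g : Γ) (x : K) (s : Kˣ) :
    (glAction v).comp (affineRep χ θ) g (ballVertex v x s) =
      ballVertex v (affineMap χ θ g x) (s / χ g) := by
  change Vertex.glAct (affineRep χ θ g) (ballVertex v x s) = _
  rw [ballVertex, Vertex.glAct_toVertex, Lattice.glAct_ofBasis]
  have hmul : ∀ z, glMap v (affineRep χ θ g) z =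
      ![(χ g : K) * z 0 + (show K from θ.1 g) * z 1, z 1] := fun z => by
    change Matrix.mulVec !![(χ g : K), (show K from θ.1 g); 0, 1] z = _
    ext i
    fin_cases i <;> simp [Matrix.mulVec, dotProduct]
  have h0 : glBasis (affineRep χ θ g) (ballBasis x s) 0 = ![(χ g : K), 0] := by
    rw [glBasis_apply (v := v), ballBasis_zero, hmul]
    simp
  have h1 : glBasis (affineRep χ θ g) (ballBasis x s) 1 = ![s * affineMap χ θ g x, s] := by
    rw [glBasis_apply (v := v), ballBasis_one, hmul]
    ext i
    fin_cases i
    · simp [affineMap]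
      ring
    · simp
  rw [toVertex_ofBasis _ (e := s) (d := χ g)]
  · congr 1
    simp [h1]
  · simp [h0, h1]
  · simp [h1]
  · simp [h0]

theorem parent_affine_smul {t : Kˣ} (ht : v (t : K) = 1) (g : Γ) (X : Vertex v) :
    parent t ((glAction v).comp (affineRep χ θ) g X) =
      (glAction v).comp (affineRep χ θ) g (parent t X) := by
  obtain ⟨x, s, rfl⟩ := exists_eq_ballVertex X
  rw [affine_smul_ballVertex, parent_ballVertex ht, parent_ballVertex ht,
    affine_smul_ballVertex, mul_div_assoc]

theorem level_affine_smul (g : Γ) (X : Vertex v) :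
    level ((glAction v).comp (affineRep χ θ) g X) =
      level X + Multiplicative.toAdd ((unitVal v).comp χ g) := by
  obtain ⟨x, s, rfl⟩ := exists_eq_ballVertex X
  rw [affine_smul_ballVertex, level_ballVertex, level_ballVertex, map_div, toAdd_div,
    MonoidHom.comp_apply]
  ring

/-- A fixed point c gives θ g = c - χ g * c, the coboundary of -c. -/
theorem H1π_eq_zero_of_fixed {c : K} (hc : ∀ g, affineMap χ θ g c = c) :
    groupCohomology.H1π (charRep χ) θ = 0 := by
  rw [groupCohomology.H1π_eq_zero_iff]
  refine ⟨(show K from -c), funext fun g => ?_⟩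
  change (χ g : K) * -c - -c = (show K from θ.1 g)
  have := hc g
  rw [affineMap] at this
  linear_combination -this

theorem val_sub_one_of_val_ne_zero {a : K} (ha : v a ≠ 0) : v (a - 1) = min (v a) 0 := by
  rw [sub_eq_add_neg, AddValuation.map_add_of_distinct_val] <;> simp [ha]

theorem exists_fixed_of_isInvariantDescent {t : Kˣ} (ht : v (t : K) = 1)
    (hχ : (unitVal v).comp χ ≠ 1) {s : ℕ → Vertex v}
    (hs : (horofunction ht).IsInvariantDescent ((glAction v).comp (affineRep χ θ)) s) :
    ∃ c : K, ∀ g, affineMap χ θ g c = c := by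
  obtain ⟨hpar, hinv⟩ := hs
  choose x u hxu using fun n => exists_eq_ballVertex (s n)
  -- So `s n` is the ball of all y with v (y - x n) ≥ n - L.
  obtain ⟨L, hL⟩ : ∃ L : ℤ, ∀ n : ℕ, Multiplicative.toAdd (unitVal v (u n)) = L - n := by
    refine ⟨Multiplicative.toAdd (unitVal v (u 0)), fun n => ?_⟩
    induction n with
    | zero => simp
    | succ n ih =>
      have := congrArg level (hpar n)
      change level (parent t _) = _ at this
      rw [level_parent ht, hxu, hxu, level_ballVertex, level_ballVertex, ih] at this
      push_cast
      lia
  have hnest : ∀ n k : ℕ, ((n - L : ℤ) : WithTop ℤ) ≤ v (x (n + k) - x n) := by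
    intro n k
    induction k with
    | zero => simp
    | succ k ih =>
      have h1 := hpar (n + k)
      change parent t _ = _ at h1
      rw [hxu, hxu, parent_ballVertex ht, ballVertex_eq_iff, map_mul, toAdd_mul, hL,
        toAdd_unitVal_of_val_eq_one ht] at h1
      have h2 := AddValuation.map_le_add v
        (le_trans (WithTop.coe_le_coe.2 (by push_cast; lia)) h1.2) ih
      rwa [sub_add_sub_cancel] at h2
  -- Comparing the levels of g (s a) and s b forces the shift b - a to be v (χ g).
  have hshift : ∀ g, ∃ a b : ℕ, (b : ℤ) = a + Multiplicative.toAdd (unitVal v (χ g)) ∧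
      ∀ k : ℕ, (((b + k : ℕ) - L : ℤ) : WithTop ℤ) ≤
        v (affineMap χ θ g (x (a + k)) - x (b + k)) := by
    intro g
    obtain ⟨a, b, hab⟩ := hinv g
    have h1 : ∀ k, _ := fun k => by
      have := hab k
      rw [hxu, hxu, affine_smul_ballVertex, ballVertex_eq_iff] at this
      exact this
    have h2 := congrArg Multiplicative.toAdd (h1 0).1
    rw [map_div, toAdd_div, hL, hL] at h2
    refine ⟨a, b, by push_cast at h2; lia, fun k => ?_⟩
    have h3 := (h1 k).2
    rw [(h1 k).1, hL, neg_sub] at h3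
    exact h3
  obtain ⟨g₀, hg₀⟩ : ∃ g, Multiplicative.toAdd (unitVal v (χ g)) ≠ 0 := by
    by_contra! h
    exact hχ (MonoidHom.ext fun g => Multiplicative.toAdd.injective (h g))
  have hv₀ : v (χ g₀ : K) ≠ 0 := by
    rw [← coe_unitVal]
    exact_mod_cast hg₀
  have hne : (χ g₀ : K) - 1 ≠ 0 := fun h => hv₀ (by rw [sub_eq_zero.1 h, AddValuation.map_one])
  -- The fixed point is found algebraically, so K need not be complete.
  obtain ⟨c, hc⟩ : ∃ c, affineMap χ θ g₀ c = c := by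
    refine ⟨-(show K from θ.1 g₀) / ((χ g₀ : K) - 1), ?_⟩
    rw [affineMap]
    field_simp
    ring
  obtain ⟨N, hN⟩ : ∃ N : ℕ, ∀ k : ℕ, (((N + k : ℕ) - L : ℤ) : WithTop ℤ) ≤ v (x (N + k) - c) := by
    obtain ⟨a, b, hb, hab⟩ := hshift g₀
    refine ⟨a, fun k => ?_⟩
    set w := Multiplicative.toAdd (unitVal v (χ g₀)) with hw
    -- Both centres lie in the larger ball, the one of smaller index. The loss `min w 0` is exactly
    -- v (χ g₀ - 1), and cancels below.
    have h1 : (((a + k : ℕ) - L + min w 0 : ℤ) : WithTop ℤ) ≤ v (x (b + k) - x (a + k)) := by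
      rcases le_total a b with h | h
      · obtain ⟨d, rfl⟩ := Nat.exists_eq_add_of_le h
        have := hnest (a + k) d
        rw [add_right_comm] at this
        exact le_trans (WithTop.coe_le_coe.2 (by lia)) this
      · obtain ⟨d, rfl⟩ := Nat.exists_eq_add_of_le h
        have := hnest (b + k) d
        rw [add_right_comm, AddValuation.map_sub_swap] at this
        exact le_trans (WithTop.coe_le_coe.2 (by lia)) this
    have h2 := AddValuation.map_le_add v
      (le_trans (WithTop.coe_le_coe.2 (by push_cast; lia)) (hab k)) h1
    have h3 : affineMap χ θ g₀ (x (a + k)) - x (b + k) + (x (b + k) - x (a + k)) =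
        ((χ g₀ : K) - 1) * (x (a + k) - c) := by
      have := affineMap_sub (θ := θ) g₀ (x (a + k)) c
      rw [hc] at this
      linear_combination this
    rw [h3, AddValuation.map_mul, val_sub_one_of_val_ne_zero hv₀, ← coe_unitVal, ← hw,
      ← WithTop.coe_zero, ← WithTop.coe_min, WithTop.coe_add, add_comm] at h2
    exact (WithTop.add_le_add_iff_left WithTop.coe_ne_top).1 h2
  refine ⟨c, fun g => ?_⟩
  obtain ⟨a, b, hb, hab⟩ := hshift g
  -- Both c and its image under g lie in the ball `s (b + (N + k))`, for every k.
  have key : ∀ k : ℕ, (((b + (N + k) : ℕ) - L : ℤ) : WithTop ℤ) ≤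
      v (affineMap χ θ g c - c) := by
    intro k
    have h1 := hab (N + k)
    have h2 := hN (b + k)
    have h3 := hN (a + k)
    rw [add_left_comm] at h2 h3
    have h4 : (((b + (N + k) : ℕ) - L : ℤ) : WithTop ℤ) ≤
        v (affineMap χ θ g (x (a + (N + k))) - affineMap χ θ g c) := by
      rw [affineMap_sub, AddValuation.map_mul, ← coe_unitVal]
      refine le_trans ?_ (add_le_add le_rfl h3)
      rw [← WithTop.coe_add, WithTop.coe_le_coe]
      push_cast
      lia
    have h5 := AddValuation.map_le_add v (AddValuation.map_le_sub v h1 h4) h2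
    convert h5 using 2
    ring
  rw [← sub_eq_zero, ← AddValuation.top_iff v]
  generalize v (affineMap χ θ g c - c) = w at key
  induction w with
  | top => rfl
  | coe w =>
    have := WithTop.coe_le_coe.1 (key (w + L).natAbs.succ)
    push_cast at this
    have := le_abs_self (w + L)
    lia

end AffineAction

end BruhatTits

theorem proposition6 {Γ K : Type u} [Group Γ] [Field K]
    (v : AddValuation K (WithTop ℤ)) (hv : Function.Surjective v)
    (χ : Γ →* Kˣ)
    (θ : groupCohomology.cocycles₁ (charRep χ))
    (hθ : groupCohomology.H1π (charRep χ) θ ≠ 0)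
    (hχ : (BruhatTits.unitVal v).comp χ ≠ 1) :
    TreeAction.IsExceptionalAction ((BruhatTits.glAction v).comp (affineRep χ θ)) ∧
    TreeAction.IsParabolicAction ((BruhatTits.glAction v).comp (affineRep χ θ)) ∧
    ¬ TreeAction.PreservesLine ((BruhatTits.glAction v).comp (affineRep χ θ)) ∧
    ∀ α : TreeAction.Boundary (BruhatTits.tree v),
      TreeAction.FixesEnd ((BruhatTits.glAction v).comp (affineRep χ θ)) α →
      TreeAction.IsBusemannCocycle ((BruhatTits.glAction v).comp (affineRep χ θ)) α
        ((BruhatTits.unitVal v).comp χ) := by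
  obtain ⟨p, hp⟩ := hv 1
  obtain ⟨t, ht⟩ : ∃ t : Kˣ, v (t : K) = 1 := ⟨Units.mk0 p (by
    rintro rfl
    simp at hp), hp⟩
  let h := BruhatTits.horofunction ht
  let X₀ : BruhatTits.Vertex v := BruhatTits.ballVertex v 0 1
  have : Nonempty (BruhatTits.Vertex v) := ⟨X₀⟩
  -- The nonvanishing of the class of θ enters only here; uniqueness of the end and absence of an
  -- invariant line both follow.
  have hno : ¬ ∃ s, h.IsInvariantDescent ((BruhatTits.glAction v).comp (affineRep χ θ)) s := by
    rintro ⟨s, hs⟩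
    obtain ⟨c, hc⟩ := BruhatTits.exists_fixed_of_isInvariantDescent ht hχ hs
    exact hθ (BruhatTits.H1π_eq_zero_of_fixed hc)
  have hfix := h.fixesEnd_ray (BruhatTits.parent_affine_smul (χ := χ) (θ := θ) ht) X₀
  have huniq : ∀ β, TreeAction.FixesEnd ((BruhatTits.glAction v).comp (affineRep χ θ)) β →
      β = (h.ray X₀).toEnd := fun β hβ =>
    (h.eq_or_exists_isInvariantDescent hβ X₀).resolve_right hno
  have hbus := h.isBusemannCocycle_ray
    (BruhatTits.level_affine_smul (v := v) (χ := χ) (θ := θ)) X₀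
  refine ⟨⟨h.isTree, _, hfix, huniq, _, hbus, hχ⟩, ⟨_, hfix⟩, fun hl => hno ?_, fun α hα => ?_⟩
  · exact h.exists_isInvariantDescent_of_preservesLine
      (BruhatTits.level_affine_smul (v := v) (χ := χ) (θ := θ)) hχ hl
  · rw [huniq α hα]
    exact hbus
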